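/- Let $G=(V,E)$ be a finite connected simple graph, and let $A_G\in\mathbb{Z}^{V\times E}$ be its unsigned incidence matrix: the entry at $(v,e)$ is $1$ if the vertex $v$ is incident with the edge $e$, and $0$ otherwise. Let $d$ be a positive integer, $\mathbb{Z}_d=\mathbb{Z}/d\mathbb{Z}$, and let $\pi_d:\mathbb{Z}^{E}\to\mathbb{Z}_d^{E}$ be the coordinatewise reduction modulo $d$. Put $\ker_{\mathbb{Z}}(A_G)=\{x\in\mathbb{Z}^E: A_Gx=0\}$ and $\ker_{\mathbb{Z}_d}(A_G)=\{x\in\mathbb{Z}_d^E: A_Gx\equiv 0 \pmod d\}$. A cycle means a closed walk; it may repeat vertices and edges. If $d$ is even and $C$ is a cycle of odd length with consecutive edges $e_1,\dots,e_k$, let $\omega_C\in\mathbb{Z}^E$ be the vector whose coordinate at $e\in E$ is $\frac d2\cdot\#\{i: e_i=e\}$. Then: 1. If $d$ is odd or $G$ has no odd cycles (that is, $G$ is bipartite), then $\ker_{\mathbb{Z}_d}(A_G)=\pi_d(\ker_{\mathbb{Z}}(A_G))$. 2. If $d$ is even and $C'$ is any odd cycle in $G$, then $$\ker_{\mathbb{Z}_d}(A_G)=\pi_d(\ker_{\mathbb{Z}}(A_G))\oplus\langle\pi_d(\omega_{C'})\rangle,$$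 an internal direct sum of $\mathbb{Z}_d$-submodules of $\mathbb{Z}_d^E$. -/

import Mathlib

/-- The unsigned incidence matrix `A_G` of a finite simple graph `G`: rows are indexed by the
vertices, columns by the edges, and the entry at `(v, e)` is `1` if `v` is incident with `e`
and `0` if not. -/
def incidenceMatrix {V : Type*} [DecidableEq V] (G : SimpleGraph V) :
    Matrix V G.edgeSet ℤ :=
  fun v e => if v ∈ (e : Sym2 V) then 1 else 0

/-- The kernel over `ℤ` of an integer matrix `M`. -/
def intKer {m n : Type*} [Fintype n] (M : Matrix m n ℤ) : Submodule ℤ (n → ℤ) :=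
  LinearMap.ker M.mulVecLin

/-- The kernel over `ℤ/d` of an integer matrix `M`: the `x : (ℤ/d)ⁿ` with `M x = 0` in `ℤ/d`. -/
def modKer {m n : Type*} [Fintype n] (d : ℕ) (M : Matrix m n ℤ) :
    Submodule (ZMod d) (n → ZMod d) :=
  LinearMap.ker (M.map (Int.castRingHom (ZMod d))).mulVecLin

/-- `ℤ → ℤ/d` is surjective; this is what makes the image of a `ℤ`-submodule under a map that is
semilinear over it a `ℤ/d`-submodule. -/
instance intCastZModSurjective (d : ℕ) : RingHomSurjective (Int.castRingHom (ZMod d)) :=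
  ⟨ZMod.intCast_surjective⟩

/-- The coordinatewise reduction modulo `d`, `π_d : ℤⁿ → (ℤ/d)ⁿ`, as a map semilinear over
`ℤ → ℤ/d`. -/
def reduceMod {n : Type*} (d : ℕ) :
    (n → ℤ) →ₛₗ[Int.castRingHom (ZMod d)] (n → ZMod d) where
  toFun x := fun i => (x i : ZMod d)
  map_add' x y := by ext i; simp
  map_smul' c x := by ext i; simp

/-- The vector `ω_C ∈ ℤ^E` of a closed walk `C` with consecutive edges `e₁, …, e_k` (edges and
vertices may repeat): its coordinate at an edge `e` is the sum, over all occurrences `e_i = e`,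
of the number adjoined to `e_i`. These numbers are `1, -1, 1, …, -1` if `k` is even, and `d/2`
at every `e_i` if `k` is odd (used only for even `d`, so that the division is exact). -/
def cycleVector {V : Type*} [DecidableEq V] {G : SimpleGraph V} (d : ℕ) {u : V}
    (C : G.Walk u u) : G.edgeSet → ℤ :=
  fun e => ∑ i : Fin C.edges.length,
    if C.edges.get i = (e : Sym2 V) then
      (if Even C.length then (-1) ^ (i : ℕ) else ((d / 2 : ℕ) : ℤ))
    else 0

/-- `G` has an odd cycle; a cycle is a closed walk, not necessarily simple. -/
def HasOddCycle {V : Type*} (G : SimpleGraph V) : Prop :=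
  ∃ (u : V) (C : G.Walk u u), Odd C.length

/-! ### The range of the incidence matrix over the integers. -/

section IncidenceMatrix

variable {V : Type*} [DecidableEq V] {G : SimpleGraph V}

/-! A residue in the kernel mod `d` lifts to some `x` with `A x = d y`, and if `y = A z` then `x - d
z` is an integral kernel vector with the same residue. So the question is whether `y` lies in the
range of `A`. With an odd cycle, even coordinate sum suffices (`mem_range_of_even_sum`), and `d ∑ y
= 2 ∑ x` forces it when `d` is odd. Without one, the range is saturated
(`mem_range_of_smul_mem_range`). For even `d`, `A ω_C = d c` with `∑ c` odd, so `ω_C` accounts for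
exactly the parity obstruction. -/

/-- The number of occurrences of each edge in a walk. -/
def walkCount {u v : V} (p : G.Walk u v) : G.edgeSet → ℤ :=
  fun e => (p.edges.count (e : Sym2 V) : ℤ)

theorem walkCount_cons {u v w : V} (h : G.Adj u v) (p : G.Walk v w) :
    walkCount (.cons h p) = Pi.single ⟨s(u, v), h⟩ 1 + walkCount p := by
  ext ⟨e, he⟩
  simp only [walkCount, SimpleGraph.Walk.edges_cons, List.count_cons, Pi.add_apply,
    Pi.single_apply, beq_iff_eq, Subtype.ext_iff, eq_comm (a := e)]
  push_cast
  ring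

theorem cycleVector_of_odd (d : ℕ) {u : V} (C : G.Walk u u) (hC : Odd C.length) :
    cycleVector d C = ((d / 2 : ℕ) : ℤ) • walkCount C := by
  ext e
  have hne : ¬ Even C.length := Nat.not_even_iff_odd.2 hC
  have hlist : ∀ l : List (Sym2 V), ∀ a : Sym2 V, ∀ m : ℤ,
      (∑ i : Fin l.length, if l.get i = a then m else 0) = m * l.count a := by
    intro l a m
    induction l with
    | nil => simp
    | cons b l ih =>
      have h1 : (∑ i : Fin (b :: l).length, if (b :: l).get i = a then m else 0) =
          (if b = a then m else 0) + ∑ i : Fin l.length, if l.get i = a then m else 0 :=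
        Fin.sum_univ_succ (n := l.length) _
      rw [h1, ih, List.count_cons]
      split_ifs <;> simp_all [mul_add, add_comm]
  simp only [cycleVector, hne, if_false, hlist, walkCount, Pi.smul_apply, smul_eq_mul]

variable [Fintype G.edgeSet]

theorem incidenceMatrix_mulVec_single {u v : V} (h : G.Adj u v) :
    (incidenceMatrix G).mulVec (Pi.single ⟨s(u, v), h⟩ 1) = Pi.single u 1 + Pi.single v 1 := by
  ext w
  have huv := h.ne
  simp only [Matrix.mulVec_single_one, Matrix.col_apply, incidenceMatrix, Sym2.mem_iff,
    Pi.add_apply, Pi.single_apply]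
  split_ifs <;> simp_all

/-- Alternating sums along walks: `e_u - (-1) ^ k e_v` is in the range of `A_G` if there is a walk
of length `k` from `u` to `v`. -/
theorem exists_incidenceMatrix_mulVec_eq_of_walk {u v : V} (p : G.Walk u v) :
    ∃ z, (incidenceMatrix G).mulVec z = Pi.single u 1 - (-1) ^ p.length • Pi.single v 1 := by
  induction p with
  | nil => exact ⟨0, by simp⟩
  | cons h p ih =>
    obtain ⟨z, hz⟩ := ih
    refine ⟨Pi.single ⟨s(_, _), h⟩ 1 - z, ?_⟩
    rw [Matrix.mulVec_sub, hz, incidenceMatrix_mulVec_single, SimpleGraph.Walk.length_cons,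
      pow_succ]
    simp only [mul_neg, mul_one, neg_smul]
    abel

variable [Fintype V]

theorem vecMul_incidenceMatrix (f : V → ℤ) {u v : V} (h : G.Adj u v) :
    (Matrix.vecMul f (incidenceMatrix G)) ⟨s(u, v), h⟩ = f u + f v := by
  have := incidenceMatrix_mulVec_single h
  have h2 : f ⬝ᵥ (incidenceMatrix G).mulVec (Pi.single ⟨s(u, v), h⟩ 1) = f u + f v := by
    rw [this, dotProduct_add, dotProduct_single, dotProduct_single, mul_one, mul_one]
  rwa [Matrix.dotProduct_mulVec, dotProduct_single, mul_one] at h2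

/-- The entries of `A_G x` sum to twice the sum of the entries of `x`. -/
theorem sum_incidenceMatrix_mulVec (x : G.edgeSet → ℤ) :
    ∑ v, (incidenceMatrix G).mulVec x v = 2 * ∑ e, x e := by
  have h : (1 : V → ℤ) ⬝ᵥ (incidenceMatrix G).mulVec x = 2 * ∑ e, x e := by
    rw [Matrix.dotProduct_mulVec, dotProduct, Finset.mul_sum]
    refine Finset.sum_congr rfl fun e _ => ?_
    obtain ⟨e, he⟩ := e
    induction e using Sym2.ind with
    | _ u v =>
      rw [vecMul_incidenceMatrix 1 he]
      norm_num
  rwa [one_dotProduct] at h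

/-- The range of `A_G` as a submodule: modulo it, `y` is a multiple of any single basis vector. -/
theorem sub_smul_single_mem_range (r : V) (p : ∀ v, G.Walk v r) (y : V → ℤ) :
    y - (∑ v, (-1) ^ (p v).length * y v) • Pi.single r 1 ∈
      LinearMap.range (incidenceMatrix G).mulVecLin := by
  have key : y - (∑ v, (-1) ^ (p v).length * y v) • Pi.single r (1 : ℤ) =
      ∑ v, y v • (Pi.single v (1 : ℤ) - (-1 : ℤ) ^ (p v).length • Pi.single r (1 : ℤ)) := by
    simp only [smul_sub, Finset.sum_sub_distrib, Finset.sum_smul, smul_smul]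
    congr 1
    · ext w
      simp [Finset.sum_apply, Pi.single_apply]
    · exact Finset.sum_congr rfl fun v _ => by rw [mul_comm]
  rw [key]
  refine Submodule.sum_mem _ fun v _ => Submodule.smul_mem _ _ ?_
  obtain ⟨z, hz⟩ := exists_incidenceMatrix_mulVec_eq_of_walk (p v)
  exact ⟨z, hz⟩

/-- In a connected graph with an odd cycle, every vector with even sum is in the range of `A_G`. -/
theorem mem_range_of_even_sum (hG : G.Connected) (hodd : HasOddCycle G) (y : V → ℤ)
    (hy : Even (∑ v, y v)) : ∃ z, (incidenceMatrix G).mulVec z = y := by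
  obtain ⟨r, C, hC⟩ := hodd
  have p : ∀ v, G.Walk v r := fun v => (hG.preconnected v r).some
  -- Going round an odd closed walk, the alternating sum returns to `r` with the same sign.
  have h2 : (2 : ℤ) • Pi.single r (1 : ℤ) ∈ LinearMap.range (incidenceMatrix G).mulVecLin := by
    obtain ⟨z, hz⟩ := exists_incidenceMatrix_mulVec_eq_of_walk C
    refine ⟨z, ?_⟩
    rw [Matrix.mulVecLin_apply, hz, hC.neg_one_pow, neg_smul, one_smul, sub_neg_eq_add, two_smul]
  have heven : Even (∑ v, (-1) ^ (p v).length * y v) := by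
    have hdiff : Even (∑ v, (-1) ^ (p v).length * y v - ∑ v, y v) := by
      rw [← Finset.sum_sub_distrib]
      refine Finset.even_sum _ fun v _ => ?_
      rcases neg_one_pow_eq_or ℤ (p v).length with h | h
      · simp [h]
      · exact ⟨-y v, by rw [h]; ring⟩
    simpa using hdiff.add hy
  obtain ⟨k, hk⟩ := heven
  have h3 := Submodule.add_mem _ (sub_smul_single_mem_range r p y) (Submodule.smul_mem _ k h2)
  rw [smul_smul, hk, ← mul_two, sub_add_cancel] at h3
  exact h3

/-- In a connected bipartite graph, the range of `A_G` is saturated. -/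
theorem mem_range_of_smul_mem_range (hG : G.Connected) (hodd : ¬ HasOddCycle G) {d : ℤ}
    (hd : d ≠ 0) {x : G.edgeSet → ℤ} {y : V → ℤ} (hxy : (incidenceMatrix G).mulVec x = d • y) :
    ∃ z, (incidenceMatrix G).mulVec z = y := by
  obtain ⟨r⟩ := hG.nonempty
  have p : ∀ v, G.Walk v r := fun v => (hG.preconnected v r).some
  -- `s` is the sign of the bipartition: equal signs at adjacent vertices would close up to an odd
  -- walk through `r`. Hence `s` annihilates the range of `A`.
  set s : V → ℤ := fun v => (-1) ^ (p v).length with hs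
  have hadj : ∀ u v, G.Adj u v → s u + s v = 0 := by
    intro u v h
    have h1 : ¬ Odd (((p u).reverse.append (.cons h (p v))).length) := fun ho => hodd ⟨_, _, ho⟩
    rw [SimpleGraph.Walk.length_append, SimpleGraph.Walk.length_reverse,
      SimpleGraph.Walk.length_cons, ← add_assoc, Nat.odd_add_one, not_not, Nat.odd_add] at h1
    simp only [hs]
    rcases Nat.even_or_odd (p u).length with hu | hu
    · have hv : Odd (p v).length := by
        rw [← Nat.not_even_iff_odd]
        exact fun hv => (Nat.not_odd_iff_even.2 hu) (h1.2 hv)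
      simp [hu.neg_one_pow, hv.neg_one_pow]
    · simp [hu.neg_one_pow, (h1.1 hu).neg_one_pow]
  have hzero : s ⬝ᵥ (incidenceMatrix G).mulVec x = 0 := by
    rw [Matrix.dotProduct_mulVec, dotProduct]
    refine Finset.sum_eq_zero fun e _ => ?_
    obtain ⟨e, he⟩ := e
    induction e using Sym2.ind with
    | _ u v => rw [vecMul_incidenceMatrix s he, hadj u v he, zero_mul]
  rw [hxy, dotProduct_smul, smul_eq_mul, mul_eq_zero, or_iff_right hd] at hzero
  have h := sub_smul_single_mem_range r p y
  have hsum : ∑ v, (-1) ^ (p v).length * y v = 0 := hzero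
  rw [hsum, zero_smul, sub_zero] at h
  exact h

/-- Each interior visit of the walk uses two edge ends; `c` counts these visits. -/
theorem exists_incidenceMatrix_mulVec_walkCount {u v : V} (p : G.Walk u v) :
    ∃ c : V → ℤ, (incidenceMatrix G).mulVec (walkCount p) =
      Pi.single u 1 + Pi.single v 1 + (2 : ℤ) • c ∧ ∑ w, c w = p.length - 1 := by
  induction p with
  | @nil u =>
    -- The empty walk has `-1` interior visits, as its two ends coincide with no edge between them.
    refine ⟨-Pi.single u 1, ?_, by simp⟩
    have : walkCount (SimpleGraph.Walk.nil : G.Walk u u) = 0 := by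
      ext e
      simp [walkCount]
    rw [this, Matrix.mulVec_zero, smul_neg, two_smul, add_neg_cancel]
  | @cons u v w h p ih =>
    obtain ⟨c, hc, hsum⟩ := ih
    refine ⟨c + Pi.single v 1, ?_, ?_⟩
    · rw [walkCount_cons, Matrix.mulVec_add, hc, incidenceMatrix_mulVec_single, smul_add,
        two_smul ℤ (Pi.single v 1)]
      abel
    · simp [Finset.sum_add_distrib, hsum]

/-- `A_G` maps the edge counts of a closed walk of length `k` to twice a vector of sum `k`. -/
theorem exists_incidenceMatrix_mulVec_walkCount_closed {u : V} (C : G.Walk u u) :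
    ∃ c : V → ℤ, (incidenceMatrix G).mulVec (walkCount C) = (2 : ℤ) • c ∧
      ∑ w, c w = C.length := by
  obtain ⟨c, hc, hsum⟩ := exists_incidenceMatrix_mulVec_walkCount C
  refine ⟨c + Pi.single u 1, ?_, ?_⟩
  · rw [hc, smul_add, two_smul ℤ (Pi.single u 1), add_comm]
  · simp [Finset.sum_add_distrib, hsum]

/-- An odd closed walk `C` satisfies `A_G ω_C = d c` for some `c` of odd sum. -/
theorem exists_incidenceMatrix_mulVec_cycleVector {d : ℕ} (hd : Even d) {u : V}
    (C : G.Walk u u) (hC : Odd C.length) :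
    ∃ c : V → ℤ, (incidenceMatrix G).mulVec (cycleVector d C) = (d : ℤ) • c ∧
      Odd (∑ w, c w) := by
  obtain ⟨c, hc, hsum⟩ := exists_incidenceMatrix_mulVec_walkCount_closed C
  refine ⟨c, ?_, by rw [hsum]; exact_mod_cast hC⟩
  rw [cycleVector_of_odd d C hC, Matrix.mulVec_smul, hc, smul_smul]
  congr 1
  exact_mod_cast Nat.div_mul_cancel hd.two_dvd

end IncidenceMatrix

/-! ### Reduction modulo `d` and lifting of kernel vectors. -/

section ReduceMod

variable {m n : Type*}

theorem reduceMod_apply (d : ℕ) (x : n → ℤ) (i : n) : reduceMod d x i = (x i : ZMod d) := rfl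

theorem reduceMod_eq_zero_iff (d : ℕ) (x : n → ℤ) :
    reduceMod d x = 0 ↔ ∃ y : n → ℤ, x = (d : ℤ) • y := by
  constructor
  · intro h
    have h' : ∀ i, ∃ k, x i = d * k := fun i =>
      (ZMod.intCast_zmod_eq_zero_iff_dvd (x i) d).1 (congrFun h i)
    choose y hy using h'
    exact ⟨y, funext hy⟩
  · rintro ⟨y, rfl⟩
    ext i
    simp [reduceMod_apply]

theorem reduceMod_surjective (d : ℕ) : Function.Surjective (reduceMod (n := n) d) := by
  intro x
  choose y hy using fun i => ZMod.intCast_surjective (x i)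
  exact ⟨y, funext hy⟩

variable [Fintype n]

theorem reduceMod_mem_modKer_iff (d : ℕ) (M : Matrix m n ℤ) (x : n → ℤ) :
    reduceMod d x ∈ modKer d M ↔ ∃ y : m → ℤ, M.mulVec x = (d : ℤ) • y := by
  have h : (M.map (Int.castRingHom (ZMod d))).mulVec (reduceMod d x) =
      fun i => ((M.mulVec x i : ℤ) : ZMod d) := by
    ext i
    simp [Matrix.mulVec, dotProduct, reduceMod_apply]
  rw [modKer, LinearMap.mem_ker, Matrix.mulVecLin_apply, h]
  constructor
  · intro h
    have h' : ∀ i, ∃ k, M.mulVec x i = d * k := fun i =>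
      (ZMod.intCast_zmod_eq_zero_iff_dvd _ d).1 (congrFun h i)
    choose y hy using h'
    exact ⟨y, funext hy⟩
  · rintro ⟨y, hy⟩
    ext i
    simp [hy]

theorem map_intKer_le_modKer (d : ℕ) (M : Matrix m n ℤ) :
    (intKer M).map (reduceMod d) ≤ modKer d M := by
  rintro _ ⟨x, hx, rfl⟩
  exact (reduceMod_mem_modKer_iff d M x).2 ⟨0, by simpa [intKer] using hx⟩

theorem reduceMod_mem_map_intKer {d : ℕ} {M : Matrix m n ℤ} {x z : n → ℤ} {y : m → ℤ}
    (hx : M.mulVec x = (d : ℤ) • y) (hz : M.mulVec z = y) :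
    reduceMod d x ∈ (intKer M).map (reduceMod d) := by
  refine ⟨x - (d : ℤ) • z, ?_, ?_⟩
  · rw [SetLike.mem_coe, intKer, LinearMap.mem_ker, Matrix.mulVecLin_apply, Matrix.mulVec_sub,
      Matrix.mulVec_smul, hx, hz, sub_self]
  · rw [map_sub, (reduceMod_eq_zero_iff d _).2 ⟨z, rfl⟩, sub_zero]

end ReduceMod

theorem proposition5p3 {V : Type*} [Fintype V] [DecidableEq V] (G : SimpleGraph V)
    [DecidableRel G.Adj] (hG : G.Connected) (d : ℕ) (hd : 0 < d) :
    ((Odd d ∨ ¬ HasOddCycle G) →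
      modKer d (incidenceMatrix G) =
        (intKer (incidenceMatrix G)).map (reduceMod d)) ∧
    (Even d → ∀ (u : V) (C' : G.Walk u u), Odd C'.length →
      modKer d (incidenceMatrix G) =
          (intKer (incidenceMatrix G)).map (reduceMod d) ⊔
            Submodule.span (ZMod d) {reduceMod d (cycleVector d C')} ∧
        Disjoint ((intKer (incidenceMatrix G)).map (reduceMod d))
          (Submodule.span (ZMod d) {reduceMod d (cycleVector d C')})) := by
  have hd0 : (d : ℤ) ≠ 0 := by exact_mod_cast hd.ne'
  refine ⟨fun h => le_antisymm (fun x hx => ?_) (map_intKer_le_modKer d _), ?_⟩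
  · obtain ⟨x, rfl⟩ := reduceMod_surjective d x
    obtain ⟨y, hy⟩ := (reduceMod_mem_modKer_iff d _ x).1 hx
    suffices hz : ∃ z, (incidenceMatrix G).mulVec z = y from
      reduceMod_mem_map_intKer hy hz.choose_spec
    by_cases hodd : HasOddCycle G
    · refine mem_range_of_even_sum hG hodd y ?_
      have hs := sum_incidenceMatrix_mulVec x
      rw [hy] at hs
      simp only [Pi.smul_apply, smul_eq_mul, ← Finset.mul_sum] at hs
      have he : Even ((d : ℤ) * ∑ v, y v) := hs ▸ even_two_mul _
      refine (Int.even_mul.1 he).resolve_left ?_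
      rw [Int.not_even_iff_odd]
      exact_mod_cast h.resolve_right (not_not.2 hodd)
    · exact mem_range_of_smul_mem_range hG hodd hd0 hy
  · intro hde u C hC
    obtain ⟨c, hc, hcodd⟩ := exists_incidenceMatrix_mulVec_cycleVector hde C hC
    refine ⟨le_antisymm (fun x hx => ?_) (sup_le (map_intKer_le_modKer d _) ?_), ?_⟩
    · obtain ⟨x, rfl⟩ := reduceMod_surjective d x
      obtain ⟨y, hy⟩ := (reduceMod_mem_modKer_iff d _ x).1 hx
      rcases Int.even_or_odd (∑ v, y v) with he | ho
      · obtain ⟨z, hz⟩ := mem_range_of_even_sum hG ⟨u, C, hC⟩ y he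
        exact Submodule.mem_sup_left (reduceMod_mem_map_intKer hy hz)
      -- Subtracting `ω_C` once replaces `y` by `y - c`, which repairs the parity.
      · have he : Even (∑ v, (y - c) v) := by
          simpa [Finset.sum_sub_distrib] using ho.sub_odd hcodd
        obtain ⟨z, hz⟩ := mem_range_of_even_sum hG ⟨u, C, hC⟩ (y - c) he
        have hxc : (incidenceMatrix G).mulVec (x - cycleVector d C) = (d : ℤ) • (y - c) := by
          rw [Matrix.mulVec_sub, hy, hc, smul_sub]
        have hmem := Submodule.add_mem_sup (reduceMod_mem_map_intKer hxc hz)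
          (Submodule.mem_span_singleton_self (R := ZMod d) (reduceMod d (cycleVector d C)))
        rwa [map_sub, sub_add_cancel] at hmem
    · rw [Submodule.span_singleton_le_iff_mem]
      exact (reduceMod_mem_modKer_iff d _ _).2 ⟨c, hc⟩
    · rw [Submodule.disjoint_def]
      rintro _ ⟨x, hx, rfl⟩ hspan
      obtain ⟨a, ha⟩ := Submodule.mem_span_singleton.1 hspan
      obtain ⟨a, rfl⟩ := ZMod.intCast_surjective a
      have hx0 : (incidenceMatrix G).mulVec x = 0 := hx
      have ha' : reduceMod d (a • cycleVector d C) = reduceMod d x := by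
        rw [← ha]
        exact map_smulₛₗ _ _ _
      obtain ⟨w, hw⟩ := (reduceMod_eq_zero_iff d (a • cycleVector d C - x)).1
        (by rw [map_sub, ha', sub_self])
      -- Apply `A` to `a ω_C - x = d w` and cancel `d`; sums in the range are even and `∑ c` is odd,
      -- so `a` is even.
      have hac : a • c = (incidenceMatrix G).mulVec w := by
        have h1 := congrArg (incidenceMatrix G).mulVec hw
        rw [Matrix.mulVec_sub, Matrix.mulVec_smul, Matrix.mulVec_smul, hx0, sub_zero, hc,
          smul_comm] at h1
        exact smul_right_injective _ hd0 h1
      have hs := sum_incidenceMatrix_mulVec w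
      rw [← hac] at hs
      simp only [Pi.smul_apply, smul_eq_mul, ← Finset.mul_sum] at hs
      have he : Even (a * ∑ v, c v) := hs ▸ even_two_mul _
      obtain ⟨b, rfl⟩ := (Int.even_mul.1 he).resolve_right (Int.not_even_iff_odd.2 hcodd)
      rw [← ha', reduceMod_eq_zero_iff]
      -- With `a = 2b`, the factor `d/2` in `ω_C` becomes `d b`.
      refine ⟨b • walkCount C, ?_⟩
      rw [cycleVector_of_odd d C hC, smul_smul, smul_smul]
      congr 1
      have h2 : ((d / 2 : ℕ) : ℤ) * 2 = d := by exact_mod_cast Nat.div_mul_cancel hde.two_dvd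
      rw [← h2]
      ring
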